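/- Let $f:\mathbb{R}^d\times\mathcal X\to\mathbb{R}$, $(\theta,x)\mapsto f(\theta;x)$, be a model such that for every input $x$ the function $f(\cdot;x)$ is $\mathcal C^2$ on $\mathbb{R}^d$ and $L$-homogeneous for a fixed real $L$, i.e. $f(s\theta;x)=s^Lf(\theta;x)$ for all $s>0$. Let $(x_i,y_i)_{i=1}^n$ with $n\ge 1$, $x_i\in\mathcal X$, $y_i\in\{-1,+1\}$ be a data set and let $\bar\theta_{\rm init}\in\mathbb{R}^d$ satisfy $f(\bar\theta_{\rm init};x)=0$ for all $x$. All gradients of $f$ are taken in $\theta$. Assume that the features $\nabla f(\bar\theta_{\rm init};x_i)$ are linearly separable: there is $h\in\mathbb{R}^d$ with $y_i\langle\nabla f(\bar\theta_{\rm init};x_i),h\rangle>0$ for all $i$. Let $h^*_{\rm ntk}$ be the unit vector in the direction of the unique minimizer of $\frac12\|h\|_2^2$ subject to $y_i\langle\nabla f(\bar\theta_{\rm init};x_i),h\rangle\ge1$ for all $i$, and let $\gamma_{\rm ntk}=\min_i y_i\langle\nabla f(\bar\theta_{\rm init};x_i),h^*_{\rm ntk}\rangle$. Let $p>0$, and for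 each $\alpha>0$ let $\lambda=\lambda(\alpha)>0$, with $\lambda(\alpha)=\Theta(\alpha^{-p})$ as $\alpha\to+\infty$. Let $\theta(t;\alpha\bar\theta_{\rm init})$, $t\ge0$, be the solution of the gradient flow $$\frac{d\theta}{dt}=-\nabla\mathcal L_\lambda(\theta),\qquad \theta(0)=\alpha\bar\theta_{\rm init},\qquad \mathcal L_\lambda(\theta)=\frac1n\sum_{i=1}^n e^{-y_if(\theta;x_i)}+\frac\lambda2\|\theta\|_2^2 .$$ Then for every $c\in(0,1)$ and every $x\in\mathcal X$, with $T_c^-(\alpha)=\frac{1-c}{\lambda}\log\alpha$, $$\lim_{\alpha\to+\infty}\frac{f\big(\theta(T_c^-(\alpha);\alpha\bar\theta_{\rm init});x\big)}{Z(\alpha)}=\big\langle\nabla f(\bar\theta_{\rm init};x),h^*_{\rm ntk}\big\rangle,\qquad Z(\alpha)=\frac1{\gamma_{\rm ntk}}\log\frac{\alpha^{2(L-1)c}}{\lambda}.$$ -/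

import Mathlib

open Filter Topology Asymptotics

noncomputable section

namespace KernelRegime

/-- Parameter space `ℝ^d` with the Euclidean norm. -/
abbrev Param (d : ℕ) := EuclideanSpace ℝ (Fin d)

variable {d n : ℕ} {X : Type*}

/-- The exponential loss `ℓ(ŷ; y) = exp (-y ŷ)`. -/
def expLoss (yhat y : ℝ) : ℝ := Real.exp (-(y * yhat))

/-- The training loss `(1/n) ∑ i, ℓ(f(θ; x_i); y_i)`. -/
def trainLoss (f : Param d → X → ℝ) (xs : Fin n → X) (ys : Fin n → ℝ) (θ : Param d) : ℝ :=
  (1 / (n : ℝ)) * ∑ i, expLoss (f θ (xs i)) (ys i)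

/-- The training loss with weight decay `lam`. -/
def regLoss (f : Param d → X → ℝ) (xs : Fin n → X) (ys : Fin n → ℝ) (lam : ℝ)
    (θ : Param d) : ℝ :=
  trainLoss f xs ys θ + lam / 2 * ‖θ‖ ^ 2

/-- `φ` solves the gradient flow `dθ/dt = -∇F(θ)` on `[0, ∞)` from `θ₀`
(with a one-sided derivative at `t = 0`). -/
def IsGradientFlow (F : Param d → ℝ) (θ₀ : Param d) (φ : ℝ → Param d) : Prop :=
  φ 0 = θ₀ ∧ ∀ t : ℝ, 0 ≤ t → HasDerivWithinAt φ (-gradient F (φ t)) (Set.Ici 0) t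

/-- The NTK feature `∇f(θ₀; x)`, the gradient being taken in the parameter. -/
def ntkFeature (f : Param d → X → ℝ) (θ₀ : Param d) (x : X) : Param d :=
  gradient (fun θ => f θ x) θ₀

/-- The vectors `h` with `y_i ⟨g_i, h⟩ ≥ 1` for all `i`. -/
def marginFeasible (g : Fin n → Param d) (ys : Fin n → ℝ) : Set (Param d) :=
  {h | ∀ i, 1 ≤ ys i * inner ℝ (g i) h}

/-- `w` minimizes `½‖h‖²` subject to `y_i ⟨g_i, h⟩ ≥ 1` for all `i`. -/
def IsMarginSolution (g : Fin n → Param d) (ys : Fin n → ℝ) (w : Param d) : Prop :=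
  w ∈ marginFeasible g ys ∧
    IsMinOn (fun h : Param d => (1 / 2 : ℝ) * ‖h‖ ^ 2) (marginFeasible g ys) w

/-- For separable features the margin problem has exactly one solution. -/
theorem existsUnique_isMarginSolution (g : Fin n → Param d) (ys : Fin n → ℝ)
    (hsep : ∃ h : Param d, ∀ i, 0 < ys i * inner ℝ (g i) h) :
    ∃! w, IsMarginSolution g ys w := by
  have hclosed : IsClosed (marginFeasible g ys) := by
    have : marginFeasible g ys = ⋂ i, {h | 1 ≤ ys i * inner ℝ (g i) h} := by
      ext h; simp [marginFeasible]
    rw [this]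
    exact isClosed_iInter fun i => isClosed_le continuous_const (by fun_prop)
  have hconv : Convex ℝ (marginFeasible g ys) := by
    intro u hu v hv a b ha hb hab i
    have h1 := hu i
    have h2 := hv i
    rw [inner_add_right, inner_smul_right, inner_smul_right]
    nlinarith [mul_le_mul_of_nonneg_left h1 ha, mul_le_mul_of_nonneg_left h2 hb]
  have hne : (marginFeasible g ys).Nonempty := by
    obtain ⟨h, hh⟩ := hsep
    refine ⟨(∑ j, (ys j * inner ℝ (g j) h)⁻¹) • h, fun i => ?_⟩
    rw [inner_smul_right]
    have h1 : (ys i * inner ℝ (g i) h)⁻¹ ≤ ∑ j, (ys j * inner ℝ (g j) h)⁻¹ :=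
      Finset.single_le_sum (f := fun j => (ys j * inner ℝ (g j) h)⁻¹)
        (fun j _ => (inv_pos.2 (hh j)).le) (Finset.mem_univ i)
    calc (1 : ℝ) = (ys i * inner ℝ (g i) h)⁻¹ * (ys i * inner ℝ (g i) h) :=
          (inv_mul_cancel₀ (hh i).ne').symm
      _ ≤ (∑ j, (ys j * inner ℝ (g j) h)⁻¹) * (ys i * inner ℝ (g i) h) :=
          mul_le_mul_of_nonneg_right h1 (hh i).le
      _ = _ := by ring
  obtain ⟨w, hw, hmin⟩ := hclosed.exists_infDist_eq_dist hne 0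
  have hle : ∀ h ∈ marginFeasible g ys, ‖w‖ ≤ ‖h‖ := by
    intro h hh
    have := Metric.infDist_le_dist_of_mem (x := (0 : Param d)) hh
    rw [hmin] at this
    simpa using this
  refine ⟨w, ⟨hw, fun h hh => ?_⟩, ?_⟩
  · have := hle h hh
    have h0 := norm_nonneg w
    simp only [Set.mem_ofPred_eq]
    nlinarith
  · rintro v ⟨hv, hvmin⟩
    have h1 : (1 / 2 : ℝ) * ‖v‖ ^ 2 ≤ 1 / 2 * ‖w‖ ^ 2 := hvmin hw
    have h2 := hle _ (hconv hv hw (a := 1 / 2) (b := 1 / 2) (by norm_num) (by norm_num)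
      (by norm_num))
    rw [← smul_add, norm_smul] at h2
    have h3 := parallelogram_law_with_norm ℝ v w
    norm_num at h2
    have h4 : ‖v - w‖ * ‖v - w‖ ≤ 0 := by
      nlinarith [norm_nonneg w, norm_nonneg (v + w)]
    have h5 : ‖v - w‖ = 0 := by nlinarith [norm_nonneg (v - w)]
    exact sub_eq_zero.1 (norm_eq_zero.1 h5)

open Classical in
/-- The solution of the margin problem (`0` if there is none). -/
def marginSolution (g : Fin n → Param d) (ys : Fin n → ℝ) : Param d :=
  if h : ∃ w, IsMarginSolution g ys w then h.choose else 0

theorem marginSolution_spec (g : Fin n → Param d) (ys : Fin n → ℝ)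
    (hsep : ∃ h : Param d, ∀ i, 0 < ys i * inner ℝ (g i) h) :
    IsMarginSolution g ys (marginSolution g ys) := by
  have h := (existsUnique_isMarginSolution g ys hsep).exists
  rw [marginSolution, dif_pos h]
  exact h.choose_spec

/-- The max-`L²`-margin direction `h*`: the normalized solution of the margin problem. -/
def maxMarginDir (g : Fin n → Param d) (ys : Fin n → ℝ) : Param d :=
  ‖marginSolution g ys‖⁻¹ • marginSolution g ys

/-- The `L²`-margin `γ = min_i y_i ⟨g_i, h*⟩`. -/
def maxMargin (g : Fin n → Param d) (ys : Fin n → ℝ) : ℝ :=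
  ⨅ i, ys i * inner ℝ (g i) (maxMarginDir g ys)

end KernelRegime

end

noncomputable section

namespace KernelRegime

variable {d n : ℕ} {X : Type*}

/-! ### The margin problem -/

/-! Let `r = α e^{-λt}` be the radius under pure weight decay and write `θ = r (θinit + r^{-L} v)`.
By homogeneity the flow becomes `v' = λ (W · (1/n) ∑ e^{-q_i} y_i G_i - L v)` with `W =
r^{2(L-1)}/λ`, `q_i = y_i f(θ; x_i)` and `G_i` the gradient at `θinit + r^{-L} v`. Up to time
`T_c^-` the radius is at least `α^c` while `v` is only of size `log α`, so `f(θ; x)` equals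
`⟨∇f(θinit; x), v⟩` up to `O(‖v‖² / r^L)`, which tends to zero.

The target is `κ w`, with `w` the max-margin direction and `κ = (log W)/γ`, so that `W e^{-κγ} = 1`.
The Lyapunov function is `‖v - κ w‖²`. The loss force is controlled by averages of `e^{-x}(1+x)`
with `x_i = q_i - κγ`; the decay force and the drift of `κ` are controlled by the dual inequality
`le_maxMargin_mul_inner`. Together (`inner_dissipation_le`) they leave an error `O(κ^{3/2})`, which
is `o(κ²)`.

`sq_norm_kernelCoord_sub_le` integrates this estimate, with a bootstrap keeping `v` where the
linearization is valid. The initial discrepancy `κ(0)²` is damped by `e^{-2LλT} = α^{-2L(1-c)}`,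
hence `v/κ → w` at `T_c^-`, where `κ = Z`. -/

/-- Variational inequality for the margin problem. -/
theorem IsMarginSolution.sq_norm_le_inner {g : Fin n → Param d} {ys : Fin n → ℝ} {w h : Param d}
    (hw : IsMarginSolution g ys w) (hh : h ∈ marginFeasible g ys) :
    ‖w‖ ^ 2 ≤ inner ℝ w h := by
  -- First-order optimality: compare `w` with a point on the segment towards `h`, divide by `t`, and
  -- let `t → 0`.
  have key : ∀ t : ℝ, 0 < t → t < 1 →
      0 ≤ 2 * (inner ℝ w h - ‖w‖ ^ 2) + t * ‖h - w‖ ^ 2 := by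
    intro t ht0 ht1
    have hmem : w + t • (h - w) ∈ marginFeasible g ys := by
      intro i
      have h1 := hw.1 i
      have h2 := hh i
      rw [inner_add_right, inner_smul_right, inner_sub_right]
      nlinarith
    have h3 : (1 / 2 : ℝ) * ‖w‖ ^ 2 ≤ 1 / 2 * ‖w + t • (h - w)‖ ^ 2 := hw.2 hmem
    rw [norm_add_sq_real, inner_smul_right, norm_smul, inner_sub_right,
      real_inner_self_eq_norm_sq, mul_pow, Real.norm_eq_abs, sq_abs] at h3
    have h4 : 0 ≤ t * (2 * (inner ℝ w h - ‖w‖ ^ 2) + t * ‖h - w‖ ^ 2) := by linarith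
    exact nonneg_of_mul_nonneg_right h4 ht0
  have hlim : Tendsto (fun t : ℝ => 2 * (inner ℝ w h - ‖w‖ ^ 2) + t * ‖h - w‖ ^ 2)
      (𝓝[>] 0) (𝓝 (2 * (inner ℝ w h - ‖w‖ ^ 2) + 0 * ‖h - w‖ ^ 2)) :=
    ((by fun_prop : Continuous fun t : ℝ =>
      2 * (inner ℝ w h - ‖w‖ ^ 2) + t * ‖h - w‖ ^ 2).tendsto 0).mono_left nhdsWithin_le_nhds
  have := ge_of_tendsto hlim (by
    filter_upwards [Ioo_mem_nhdsGT (zero_lt_one' ℝ)] with t ht using key t ht.1 ht.2)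
  linarith

/-- Adding `s • w` raises every margin by at least `s`, so for `a + s > 0` the rescaled vector is
feasible even when `a ≤ 0`. The shift contributes `s‖w‖²` to both sides and cancels. This replaces
the KKT multipliers. -/
theorem IsMarginSolution.mul_sq_norm_le_inner {g : Fin n → Param d} {ys : Fin n → ℝ}
    {w v : Param d} (hw : IsMarginSolution g ys w) {a : ℝ}
    (hv : ∀ i, a ≤ ys i * inner ℝ (g i) v) : a * ‖w‖ ^ 2 ≤ inner ℝ w v := by
  set s : ℝ := |a| + 1
  have hs : 0 < a + s := by have := neg_abs_le a; simp only [s]; linarith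
  have hs0 : 0 ≤ s := by positivity
  have hmem : (a + s)⁻¹ • (v + s • w) ∈ marginFeasible g ys := by
    intro i
    rw [inner_smul_right, inner_add_right, inner_smul_right, mul_left_comm, inv_mul_eq_div,
      one_le_div hs]
    nlinarith [hv i, hw.1 i]
  have h1 := hw.sq_norm_le_inner hmem
  rw [inner_smul_right, inner_add_right, inner_smul_right, real_inner_self_eq_norm_sq,
    inv_mul_eq_div, le_div_iff₀ hs] at h1
  linarith

theorem marginSolution_ne_zero (hn : 0 < n) {g : Fin n → Param d} {ys : Fin n → ℝ}
    (hsep : ∃ h : Param d, ∀ i, 0 < ys i * inner ℝ (g i) h) : marginSolution g ys ≠ 0 := by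
  intro h0
  have := (marginSolution_spec g ys hsep).1 ⟨0, hn⟩
  rw [h0, inner_zero_right, mul_zero] at this
  linarith

theorem norm_maxMarginDir (hn : 0 < n) {g : Fin n → Param d} {ys : Fin n → ℝ}
    (hsep : ∃ h : Param d, ∀ i, 0 < ys i * inner ℝ (g i) h) : ‖maxMarginDir g ys‖ = 1 :=
  norm_smul_inv_norm (𝕜 := ℝ) (marginSolution_ne_zero hn hsep)

theorem maxMargin_le (g : Fin n → Param d) (ys : Fin n → ℝ) (i : Fin n) :
    maxMargin g ys ≤ ys i * inner ℝ (g i) (maxMarginDir g ys) :=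
  ciInf_le (Set.finite_range _).bddBelow i

theorem maxMargin_eq (hn : 0 < n) {g : Fin n → Param d} {ys : Fin n → ℝ}
    (hsep : ∃ h : Param d, ∀ i, 0 < ys i * inner ℝ (g i) h) :
    maxMargin g ys = ‖marginSolution g ys‖⁻¹ := by
  have : Nonempty (Fin n) := ⟨⟨0, hn⟩⟩
  have hw := marginSolution_spec g ys hsep
  have hpos : 0 < ‖marginSolution g ys‖ := norm_pos_iff.2 (marginSolution_ne_zero hn hsep)
  apply le_antisymm
  · have h1 := hw.mul_sq_norm_le_inner (maxMargin_le g ys)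
    rw [maxMarginDir, inner_smul_right, real_inner_self_eq_norm_sq] at h1
    exact le_of_mul_le_mul_right h1 (by positivity)
  · refine le_ciInf fun i => ?_
    rw [maxMarginDir, inner_smul_right, mul_left_comm]
    exact le_mul_of_one_le_right (by positivity) (hw.1 i)

theorem maxMargin_pos (hn : 0 < n) {g : Fin n → Param d} {ys : Fin n → ℝ}
    (hsep : ∃ h : Param d, ∀ i, 0 < ys i * inner ℝ (g i) h) : 0 < maxMargin g ys := by
  rw [maxMargin_eq hn hsep]
  exact inv_pos.2 (norm_pos_iff.2 (marginSolution_ne_zero hn hsep))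

/-- The max-margin direction is a nonnegative combination of the signed features, in dual form. -/
theorem le_maxMargin_mul_inner (hn : 0 < n) {g : Fin n → Param d} {ys : Fin n → ℝ}
    (hsep : ∃ h : Param d, ∀ i, 0 < ys i * inner ℝ (g i) h) {v : Param d} {a : ℝ}
    (hv : ∀ i, a ≤ ys i * inner ℝ (g i) v) :
    a ≤ maxMargin g ys * inner ℝ (maxMarginDir g ys) v := by
  have hw := (marginSolution_spec g ys hsep).mul_sq_norm_le_inner hv
  have hpos : 0 < ‖marginSolution g ys‖ := norm_pos_iff.2 (marginSolution_ne_zero hn hsep)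
  rw [maxMargin_eq hn hsep, maxMarginDir, inner_smul_left]
  calc a = ‖marginSolution g ys‖⁻¹ * (‖marginSolution g ys‖⁻¹ *
        (a * ‖marginSolution g ys‖ ^ 2)) := by field_simp
    _ ≤ _ := by
      simp only [conj_trivial]
      gcongr

/-! ### The dissipation inequality -/

theorem exp_neg_mul_one_add_le (x : ℝ) : Real.exp (-x) * (1 + x) ≤ 1 := by
  have h := Real.add_one_le_exp x
  calc Real.exp (-x) * (1 + x) ≤ Real.exp (-x) * Real.exp x := by gcongr; linarith
    _ = 1 := by rw [← Real.exp_add]; simp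

/-- A cubic gain suffices: played against a linear term `a y` it leaves `O(a^{3/2})`, whereas a
quadratic gain would leave order `a²`, which is not negligible against `κ²`. -/
theorem exp_mul_one_sub_le {y : ℝ} (hy : 0 ≤ y) : Real.exp y * (1 - y) ≤ 2 - y ^ 3 / 2 := by
  rcases le_total y 1 with h | h
  · have h1 := exp_neg_mul_one_add_le (-y)
    rw [neg_neg] at h1
    have h2 : y ^ 3 ≤ 1 := pow_le_one₀ hy h
    have h3 : 1 - y = 1 + -y := by ring
    rw [h3]
    linarith
  · have h1 := Real.quadratic_le_exp_of_nonneg hy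
    nlinarith [pow_nonneg hy 3]

/-- The error term in the dissipation inequality. -/
def dissipationError (n : ℕ) (a : ℝ) : ℝ := a + a * √(2 * n * a) + 2

theorem dissipationError_mono {a b : ℝ} (ha : 0 ≤ a) (hab : a ≤ b) :
    dissipationError n a ≤ dissipationError n b := by
  unfold dissipationError
  have : √(2 * n * a) ≤ √(2 * n * b) := by gcongr
  have := mul_le_mul hab this (by positivity) (ha.trans hab)
  linarith

/-- The terms `a y` and `y³/(2n)` balance at `y = √(2na)`: below this value `a y` is at most
`a√(2na)`, above it the cubic absorbs it. -/
theorem mul_one_add_sub_cube_le (hn : 0 < n) {a y : ℝ} (ha : 0 ≤ a) (hy : 0 ≤ y) :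
    a * (1 + y) + 2 - y ^ 3 / (2 * n) ≤ dissipationError n a := by
  unfold dissipationError
  have hn' : (0 : ℝ) < n := by exact_mod_cast hn
  rcases le_total y (√(2 * n * a)) with h | h
  · have h1 : a * y ≤ a * √(2 * n * a) := by gcongr
    have h2 : 0 ≤ y ^ 3 / (2 * n) := by positivity
    linarith
  · have h1 : 2 * n * a ≤ y ^ 2 := by
      rw [← Real.sqrt_le_left hy]; exact h
    have h2 : a * y ≤ y ^ 3 / (2 * n) := by
      rw [le_div_iff₀ (by positivity)]
      nlinarith
    have h3 : 0 ≤ a * √(2 * n * a) := by positivity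
    linarith

/-- The average of `e^{-x}(1+x)` is very negative when the smallest entry is. -/
theorem exists_avg_exp_neg_mul_one_add_le (hn : 0 < n) (x : Fin n → ℝ) :
    ∃ y : ℝ, 0 ≤ y ∧ (∀ i, -y ≤ x i) ∧
      (1 / (n : ℝ)) * ∑ i, Real.exp (-x i) * (1 + x i) ≤ 2 - y ^ 3 / (2 * n) := by
  have : Nonempty (Fin n) := ⟨⟨0, hn⟩⟩
  have hn' : (1 : ℝ) ≤ n := by exact_mod_cast hn
  obtain ⟨j, hj⟩ := Finite.exists_min x
  refine ⟨max 0 (-x j), le_max_left _ _, fun i => ?_, ?_⟩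
  · have := le_max_right 0 (-x j)
    linarith [hj i]
  set y := max 0 (-x j)
  have hxj : Real.exp (-x j) * (1 + x j) ≤ 2 - y ^ 3 / 2 := by
    rcases le_total (-x j) 0 with h | h
    · have hy : y = 0 := max_eq_left h
      have := exp_neg_mul_one_add_le (x j)
      rw [hy]; norm_num; linarith
    · have hy : y = -x j := max_eq_right h
      have := exp_mul_one_sub_le h
      rw [hy, show 1 + x j = 1 - -x j by ring]
      exact this
  -- The smallest entry supplies `2 - y³/2`; each of the other `n - 1` terms is at most `1`.
  have hsum : ∑ i, Real.exp (-x i) * (1 + x i) ≤ n + 1 - y ^ 3 / 2 := by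
    rw [← Finset.add_sum_erase _ _ (Finset.mem_univ j)]
    have h1 : ∑ i ∈ Finset.univ.erase j, Real.exp (-x i) * (1 + x i) ≤
        ∑ i ∈ Finset.univ.erase j, (1 : ℝ) :=
      Finset.sum_le_sum fun i _ => exp_neg_mul_one_add_le (x i)
    rw [Finset.sum_const, Finset.card_erase_of_mem (Finset.mem_univ j), Finset.card_univ,
      Fintype.card_fin, nsmul_eq_mul, mul_one, Nat.cast_sub hn] at h1
    push_cast at h1
    linarith
  calc (1 / (n : ℝ)) * ∑ i, Real.exp (-x i) * (1 + x i)
      ≤ (1 / (n : ℝ)) * (n + 1 - y ^ 3 / 2) := by gcongr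
    _ = 1 + 1 / n - y ^ 3 / (2 * n) := by field_simp
    _ ≤ 2 - y ^ 3 / (2 * n) := by
      have : 1 / (n : ℝ) ≤ 1 := by rw [div_le_one (by linarith)]; exact hn'
      linarith

/-- Dissipation towards `κ • w`, where `w` is the max-margin direction. -/
theorem inner_dissipation_le (hn : 0 < n) {g G : Fin n → Param d} {ys q : Fin n → ℝ}
    (hsep : ∃ h : Param d, ∀ i, 0 < ys i * inner ℝ (g i) h)
    {L κ b W : ℝ} {v : Param d} (hb : 0 ≤ b) (hbκ : b ≤ L * κ)
    (hW : W * Real.exp (-(κ * maxMargin g ys)) = 1)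
    (hq : ∀ i, q i - 1 ≤ ys i * inner ℝ (g i) v)
    (hG : ∀ i, ys i * inner ℝ (G i) (v - κ • maxMarginDir g ys) ≤
      q i - κ * maxMargin g ys + 1) :
    inner ℝ (v - κ • maxMarginDir g ys)
      ((W * (1 / (n : ℝ))) • ∑ i, (Real.exp (-q i) * ys i) • G i - L • v
        + b • maxMarginDir g ys) ≤
      -L * ‖v - κ • maxMarginDir g ys‖ ^ 2 + dissipationError n (L * κ / maxMargin g ys) := by
  set w := maxMarginDir g ys with hw
  set γ := maxMargin g ys with hγ
  have hγ0 : 0 < γ := maxMargin_pos hn hsep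
  have hw1 : ‖w‖ = 1 := norm_maxMarginDir hn hsep
  have hWpos : 0 < W := by
    by_contra h
    have := mul_nonpos_of_nonpos_of_nonneg (not_lt.1 h) (Real.exp_pos (-(κ * γ))).le
    linarith
  -- Centering at `κγ` absorbs `W`: `W e^{-q_i} = e^{-(q_i - κγ)}`.
  obtain ⟨y, hy0, hyx, hsum⟩ := exists_avg_exp_neg_mul_one_add_le hn (fun i => q i - κ * γ)
  have h1 : inner ℝ (v - κ • w) ((W * (1 / (n : ℝ))) • ∑ i, (Real.exp (-q i) * ys i) • G i)
      ≤ 2 - y ^ 3 / (2 * n) := by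
    refine le_trans ?_ hsum
    rw [inner_smul_right, inner_sum, mul_comm W, mul_assoc]
    gcongr
    rw [Finset.mul_sum]
    refine Finset.sum_le_sum fun i _ => ?_
    rw [inner_smul_right, real_inner_comm]
    have h2 : Real.exp (-(q i - κ * γ)) = W * Real.exp (-q i) := by
      rw [show -(q i - κ * γ) = -q i - -(κ * γ) by ring, Real.exp_sub, div_eq_iff (Real.exp_ne_zero _),
        mul_right_comm, hW, one_mul]
    rw [h2, mul_assoc, mul_assoc]
    gcongr
    linarith [hG i]
  -- All linearized margins are at least `κγ - y - 1`, so duality keeps `v` from falling far short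
  -- of `κ` along `w`.
  have h3 : κ * γ - y - 1 ≤ γ * inner ℝ w v :=
    le_maxMargin_mul_inner hn hsep fun i => by linarith [hq i, hyx i]
  have hww : inner ℝ w w = (1 : ℝ) := by rw [real_inner_self_eq_norm_sq, hw1]; norm_num
  have h4 : -((1 + y) / γ) ≤ inner ℝ w (v - κ • w) := by
    rw [inner_sub_right, inner_smul_right, hww, neg_le_iff_add_nonneg, ← sub_nonneg]
    have : inner ℝ w v - κ * 1 + (1 + y) / γ - 0 = (γ * inner ℝ w v - κ * γ + (1 + y)) / γ := by
      field_simp; ring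
    rw [this]
    exact div_nonneg (by linarith) hγ0.le
  have h5 : inner ℝ (v - κ • w) (L • v) =
      L * ‖v - κ • w‖ ^ 2 + L * κ * inner ℝ w (v - κ • w) := by
    have : L • v = L • (v - κ • w) + (L * κ) • w := by module
    rw [this, inner_add_right, inner_smul_right, inner_smul_right, real_inner_self_eq_norm_sq,
      real_inner_comm]
  rw [inner_add_right, inner_sub_right, h5, inner_smul_right _ _ b,
    real_inner_comm w (v - κ • w)]
  have h6 : -((L * κ - b) * inner ℝ w (v - κ • w)) ≤ L * κ / γ * (1 + y) := by
    calc -((L * κ - b) * inner ℝ w (v - κ • w)) ≤ (L * κ - b) * ((1 + y) / γ) := by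
          nlinarith [mul_le_mul_of_nonneg_left h4 (sub_nonneg.2 hbκ)]
      _ ≤ L * κ * ((1 + y) / γ) := by gcongr; linarith
      _ = _ := by ring
  have h7 := mul_one_add_sub_cube_le hn (div_nonneg (hb.trans hbκ) hγ0.le) hy0
  linarith

/-! ### Gradients -/

theorem contDiff_gradient {F : Param d → ℝ} (hF : ContDiff ℝ 2 F) : ContDiff ℝ 1 (gradient F) :=
  (InnerProductSpace.toDual ℝ (Param d)).symm.contDiff.comp
    (hF.fderiv_right (m := 1) (by norm_num))

theorem gradient_smul_of_homogeneous {F : Param d → ℝ} {L : ℝ}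
    (hhom : ∀ (θ : Param d) (s : ℝ), 0 < s → F (s • θ) = s ^ L * F θ) {s : ℝ} (hs : 0 < s)
    (θ : Param d) : gradient F (s • θ) = s ^ (L - 1) • gradient F θ := by
  have h1 : s • fderiv ℝ F (s • θ) = s ^ L • fderiv ℝ F θ := by
    rw [← fderiv_comp_smul, funext fun θ => hhom θ s hs]
    exact congrFun (fderiv_const_smul_field (𝕜 := ℝ) (s ^ L) (f := F)) θ
  have h2 : fderiv ℝ F (s • θ) = s ^ (L - 1) • fderiv ℝ F θ := by
    rw [Real.rpow_sub_one hs.ne', div_eq_inv_mul, mul_smul, ← h1, smul_smul,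
      inv_mul_cancel₀ hs.ne', one_smul]
  simp [gradient, h2]

/-- A `C¹` positively homogeneous function with a nonzero gradient has degree at least one. -/
theorem one_le_of_homogeneous {F : Param d → ℝ} (hF : ContDiff ℝ 2 F) {L : ℝ}
    (hhom : ∀ (θ : Param d) (s : ℝ), 0 < s → F (s • θ) = s ^ L * F θ) {θ : Param d}
    (hne : gradient F θ ≠ 0) : 1 ≤ L := by
  by_contra! hL
  -- For `L < 1` the gradient along the ray grows like `s^{L-1}` as `s → 0`, against its continuity
  -- at the origin.
  have h1 : Tendsto (fun s : ℝ => ‖gradient F (s • θ)‖) (𝓝[>] 0) (𝓝 ‖gradient F ((0 : ℝ) • θ)‖) :=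
    (((contDiff_gradient hF).continuous.comp (continuous_id.smul continuous_const)).norm.tendsto
      0).mono_left nhdsWithin_le_nhds
  have h2 : Tendsto (fun s : ℝ => s ^ (L - 1) * ‖gradient F θ‖) (𝓝[>] 0) atTop :=
    (tendsto_rpow_neg_nhdsGT_zero (by linarith)).atTop_mul_const (norm_pos_iff.2 hne)
  refine not_tendsto_nhds_of_tendsto_atTop h2 _ (h1.congr' ?_)
  filter_upwards [self_mem_nhdsWithin] with s hs
  have hs' : 0 < s := hs
  rw [gradient_smul_of_homogeneous hhom hs', norm_smul,
    Real.norm_of_nonneg (Real.rpow_nonneg hs'.le _)]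

/-- Near `θ₀` the function is affine up to a quadratic error, with constant `C` in radius `ρ`. -/
def IsQuadApprox (F : Param d → ℝ) (θ₀ : Param d) (C ρ : ℝ) : Prop :=
  ∀ u : Param d, ‖u‖ ≤ ρ → ‖gradient F (θ₀ + u) - gradient F θ₀‖ ≤ C * ‖u‖ ∧
    |F (θ₀ + u) - F θ₀ - inner ℝ (gradient F θ₀) u| ≤ C * ‖u‖ ^ 2

/-- The gradient is `C¹`, hence Lipschitz near `θ₀`; the mean value inequality on the ball of radius
`‖u‖` turns this into the quadratic remainder. -/
theorem exists_isQuadApprox {F : Param d → ℝ} (hF : ContDiff ℝ 2 F) (θ₀ : Param d) :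
    ∃ C ρ : ℝ, 0 < ρ ∧ IsQuadApprox F θ₀ C ρ := by
  obtain ⟨K, t, ht, hlip⟩ := (contDiff_gradient hF).contDiffAt.exists_lipschitzOnWith (x := θ₀)
  obtain ⟨ρ, hρ, hball⟩ := Metric.nhds_basis_closedBall.mem_iff.1 ht
  have hgrad : ∀ u : Param d, ‖u‖ ≤ ρ →
      ‖gradient F (θ₀ + u) - gradient F θ₀‖ ≤ K * ‖u‖ := by
    intro u hu
    have := hlip.norm_sub_le (x := θ₀ + u) (y := θ₀) (hball (by simpa using hu))
      (hball (by simpa using hρ.le))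
    simpa using this
  refine ⟨K, ρ, hρ, fun u hu => ⟨hgrad u hu, ?_⟩⟩
  have hd : ∀ z ∈ Metric.closedBall θ₀ ‖u‖,
      HasFDerivWithinAt F (fderiv ℝ F z) (Metric.closedBall θ₀ ‖u‖) z := fun z _ =>
    ((hF.differentiable (by norm_num)) z).hasFDerivAt.hasFDerivWithinAt
  have hbound : ∀ z ∈ Metric.closedBall θ₀ ‖u‖, ‖fderiv ℝ F z - fderiv ℝ F θ₀‖ ≤ K * ‖u‖ := by
    intro z hz
    have hz' : ‖z - θ₀‖ ≤ ‖u‖ := by simpa [dist_eq_norm] using hz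
    have h := hgrad (z - θ₀) (hz'.trans hu)
    rw [add_sub_cancel] at h
    rw [← toDual_gradient, ← toDual_gradient, ← map_sub, LinearIsometryEquiv.norm_map]
    exact h.trans (by gcongr)
  have h := (convex_closedBall θ₀ ‖u‖).norm_image_sub_le_of_norm_hasFDerivWithin_le' hd hbound
    (Metric.mem_closedBall_self (norm_nonneg u)) (y := θ₀ + u) (by simp)
  rw [add_sub_cancel_left, Real.norm_eq_abs, ← inner_gradient_left] at h
  linarith

theorem IsQuadApprox.mono {F : Param d → ℝ} {θ₀ : Param d} {C C' ρ ρ' : ℝ}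
    (h : IsQuadApprox F θ₀ C ρ) (hC : C ≤ C') (hρ : ρ' ≤ ρ) : IsQuadApprox F θ₀ C' ρ' :=
  fun u hu => ⟨(h u (hu.trans hρ)).1.trans (by gcongr), (h u (hu.trans hρ)).2.trans (by gcongr)⟩

theorem exists_forall_isQuadApprox {ι : Type*} [Finite ι] {F : ι → Param d → ℝ}
    (hF : ∀ i, ContDiff ℝ 2 (F i)) (θ₀ : Param d) :
    ∃ C ρ : ℝ, 0 ≤ C ∧ 0 < ρ ∧ ∀ i, IsQuadApprox (F i) θ₀ C ρ := by
  choose C ρ hρ h using fun i => exists_isQuadApprox (hF i) θ₀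
  have h1 : ∀ᶠ c in atTop, ∀ i, C i ≤ c := eventually_all.2 fun i => eventually_ge_atTop _
  have h2 : ∀ᶠ r in 𝓝[>] (0 : ℝ), ∀ i, r ≤ ρ i := eventually_all.2 fun i => by
    filter_upwards [Ioo_mem_nhdsGT (hρ i)] with r hr using hr.2.le
  obtain ⟨c, hc, hc0⟩ := (h1.and (eventually_ge_atTop 0)).exists
  obtain ⟨r, hr, hr0⟩ := (h2.and self_mem_nhdsWithin).exists
  exact ⟨c, r, hc0, hr0, fun i => (h i).mono (hc i) (hr i)⟩

theorem gradient_regLoss {f : Param d → X → ℝ} (hf : ∀ x, Differentiable ℝ fun θ => f θ x)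
    (xs : Fin n → X) (ys : Fin n → ℝ) (lam : ℝ) (θ : Param d) :
    gradient (regLoss f xs ys lam) θ =
      -((1 / (n : ℝ)) • ∑ i, (Real.exp (-(ys i * f θ (xs i))) * ys i) •
        gradient (fun θ => f θ (xs i)) θ) + lam • θ := by
  have h1 : ∀ i, HasFDerivAt (fun θ => expLoss (f θ (xs i)) (ys i))
      (Real.exp (-(ys i * f θ (xs i))) • (-(ys i • fderiv ℝ (fun θ => f θ (xs i)) θ))) θ :=
    fun i => (((hf (xs i) θ).hasFDerivAt.const_mul (ys i)).neg).exp
  have h2 : HasFDerivAt (fun θ : Param d => ‖θ‖ ^ 2) (2 • innerSL ℝ θ) θ :=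
    (hasStrictFDerivAt_norm_sq θ).hasFDerivAt
  have h3 := ((HasFDerivAt.fun_sum (u := Finset.univ) fun i _ => h1 i).const_mul
    (1 / (n : ℝ))).add (h2.const_mul (lam / 2))
  apply HasGradientAt.gradient
  rw [hasGradientAt_iff_hasFDerivAt]
  refine h3.congr_fderiv (ContinuousLinearMap.ext fun z => ?_)
  simp only [InnerProductSpace.toDual_apply_apply, inner_add_left, inner_neg_left,
    real_inner_smul_left, sum_inner, inner_gradient_left, add_apply, neg_apply, smul_apply,
    sum_apply, innerSL_apply_apply, smul_eq_mul, mul_neg, Finset.sum_neg_distrib, nsmul_eq_mul,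
    mul_assoc]
  push_cast
  ring

/-! ### The flow in kernel coordinates -/

/-- Logarithm of the radius of the pure weight-decay trajectory started at radius `α`. -/
def logRadius (α lam t : ℝ) : ℝ := Real.log α - lam * t

/-- The displacement from the weight-decay trajectory, scaled so that the outputs of the model are
linear in it to leading order. -/
def kernelCoord (L : ℝ) (θinit : Param d) (α lam : ℝ) (φ : ℝ → Param d) (t : ℝ) : Param d :=
  Real.exp ((L - 1) * logRadius α lam t) • φ t - Real.exp (L * logRadius α lam t) • θinit

theorem hasDerivAt_logRadius (α lam t : ℝ) : HasDerivAt (logRadius α lam) (-lam) t :=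
  (((hasDerivAt_id t).const_mul lam).const_sub (Real.log α)).congr_deriv (by simp)

/-- The predicted norm of `kernelCoord`. -/
def targetNorm (L γ α lam t : ℝ) : ℝ := (2 * (L - 1) * logRadius α lam t - Real.log lam) / γ

theorem eq_exp_smul_kernelCoord (L : ℝ) (θinit : Param d) (α lam : ℝ) (φ : ℝ → Param d) (t : ℝ) :
    φ t = Real.exp (logRadius α lam t) •
      (θinit + Real.exp (-(L * logRadius α lam t)) • kernelCoord L θinit α lam φ t) := by
  set l := logRadius α lam t
  have h1 : Real.exp l * (Real.exp (-(L * l)) * Real.exp ((L - 1) * l)) = 1 := by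
    rw [← Real.exp_add, ← Real.exp_add, Real.exp_eq_one_iff]; ring
  have h2 : Real.exp l * (Real.exp (-(L * l)) * Real.exp (L * l)) = Real.exp l := by
    rw [← Real.exp_add (-(L * l)), neg_add_cancel, Real.exp_zero, mul_one]
  change φ t = Real.exp l • (θinit + Real.exp (-(L * l)) •
    (Real.exp ((L - 1) * l) • φ t - Real.exp (L * l) • θinit))
  simp only [smul_add, smul_sub, smul_smul]
  rw [h1, h2]
  module

/-- The outputs of the model are linear in the kernel coordinate to leading order. -/
theorem abs_sub_inner_kernelCoord_le {f : Param d → X → ℝ} {L : ℝ}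
    (hhom : ∀ (x : X) (θ : Param d) (s : ℝ), 0 < s → f (s • θ) x = s ^ L * f θ x)
    {θinit : Param d} {x : X} (hinit : f θinit x = 0) {C ρ : ℝ}
    (hquad : IsQuadApprox (fun θ => f θ x) θinit C ρ) {α lam : ℝ} {φ : ℝ → Param d} {t : ℝ}
    (hρ : ‖kernelCoord L θinit α lam φ t‖ / Real.exp (L * logRadius α lam t) ≤ ρ) :
    |f (φ t) x - inner ℝ (ntkFeature f θinit x) (kernelCoord L θinit α lam φ t)| ≤
      C * ‖kernelCoord L θinit α lam φ t‖ ^ 2 / Real.exp (L * logRadius α lam t) := by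
  have hφ := eq_exp_smul_kernelCoord L θinit α lam φ t
  set v := kernelCoord L θinit α lam φ t
  set M := Real.exp (L * logRadius α lam t) with hM
  have hM0 : 0 < M := Real.exp_pos _
  rw [Real.exp_neg, ← hM] at hφ
  have hun : ‖M⁻¹ • v‖ = ‖v‖ / M := by
    rw [norm_smul, norm_inv, Real.norm_of_nonneg hM0.le, inv_mul_eq_div]
  have h : |f (θinit + M⁻¹ • v) x - f θinit x - inner ℝ (ntkFeature f θinit x) (M⁻¹ • v)| ≤
      C * ‖M⁻¹ • v‖ ^ 2 := (hquad _ (hun ▸ hρ)).2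
  rw [hinit, sub_zero, inner_smul_right, hun] at h
  rw [hφ, hhom _ _ _ (Real.exp_pos _), ← Real.exp_mul, mul_comm (logRadius α lam t), ← hM]
  generalize inner ℝ (ntkFeature f θinit x) v = a at *
  calc |M * f (θinit + M⁻¹ • v) x - a| = M * |f (θinit + M⁻¹ • v) x - M⁻¹ * a| := by
        rw [← abs_of_pos hM0, ← abs_mul, abs_of_pos hM0, mul_sub, mul_inv_cancel_left₀ hM0.ne']
    _ ≤ M * (C * (‖v‖ / M) ^ 2) := by gcongr
    _ = _ := by field_simp

theorem kernelCoord_zero (L : ℝ) (θinit : Param d) {α : ℝ} (hα : 0 < α) (lam : ℝ)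
    {φ : ℝ → Param d} (hφ : φ 0 = α • θinit) : kernelCoord L θinit α lam φ 0 = 0 := by
  have h : Real.exp ((L - 1) * Real.log α) * α = Real.exp (L * Real.log α) := by
    nth_rewrite 2 [← Real.exp_log hα]
    rw [← Real.exp_add]; congr 1; ring
  simp [kernelCoord, logRadius, hφ, smul_smul, h]

/-- The derivatives of the two exponential prefactors combine with the weight decay into `-λ L v`.
The loss gradient carries `r^{L-1}` twice, from the coordinate and from homogeneity; factoring out
`λ` leaves the weight `r^{2(L-1)}/λ`. -/
theorem hasDerivWithinAt_kernelCoord {f : Param d → X → ℝ}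
    (hf : ∀ x, Differentiable ℝ fun θ => f θ x) {L : ℝ}
    (hhom : ∀ (x : X) (θ : Param d) (s : ℝ), 0 < s → f (s • θ) x = s ^ L * f θ x)
    {xs : Fin n → X} {ys : Fin n → ℝ} {θinit : Param d} {α lam : ℝ} (hlam : 0 < lam)
    {φ : ℝ → Param d} (hφ : IsGradientFlow (regLoss f xs ys lam) (α • θinit) φ) {t : ℝ}
    (ht : 0 ≤ t) :
    HasDerivWithinAt (kernelCoord L θinit α lam φ)
      (lam • ((Real.exp (2 * (L - 1) * logRadius α lam t - Real.log lam) * (1 / (n : ℝ))) •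
        ∑ i, (Real.exp (-(ys i * f (φ t) (xs i))) * ys i) •
          gradient (fun θ => f θ (xs i)) (θinit + Real.exp (-(L * logRadius α lam t)) •
            kernelCoord L θinit α lam φ t) - L • kernelCoord L θinit α lam φ t)) (Set.Ici t) t := by
  have hφ' := (hφ.2 t ht).mono (Set.Ici_subset_Ici.2 ht)
  have hl := hasDerivAt_logRadius α lam t
  have hd := ((((hl.const_mul (L - 1)).exp).hasDerivWithinAt (s := Set.Ici t)).smul hφ').sub
    ((((hl.const_mul L).exp).hasDerivWithinAt (s := Set.Ici t)).smul_const θinit)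
  refine hd.congr_deriv ?_
  have hgrad : ∀ i, gradient (fun θ => f θ (xs i)) (φ t) =
      Real.exp ((L - 1) * logRadius α lam t) • gradient (fun θ => f θ (xs i))
        (θinit + Real.exp (-(L * logRadius α lam t)) • kernelCoord L θinit α lam φ t) := by
    intro i
    conv_lhs => rw [eq_exp_smul_kernelCoord L θinit α lam φ t]
    rw [gradient_smul_of_homogeneous (hhom (xs i)) (Real.exp_pos _), ← Real.exp_mul,
      mul_comm (logRadius α lam t)]
  have hW : lam * Real.exp (2 * (L - 1) * logRadius α lam t - Real.log lam) =
      Real.exp ((L - 1) * logRadius α lam t) * Real.exp ((L - 1) * logRadius α lam t) := by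
    rw [Real.exp_sub, Real.exp_log hlam, mul_div_cancel₀ _ hlam.ne', ← Real.exp_add]
    congr 1; ring
  rw [gradient_regLoss hf]
  simp only [hgrad]
  have hsum : ∀ V : Fin n → Param d, ∑ i, (Real.exp (-(ys i * f (φ t) (xs i))) * ys i) •
      Real.exp ((L - 1) * logRadius α lam t) • V i = Real.exp ((L - 1) * logRadius α lam t) •
        ∑ i, (Real.exp (-(ys i * f (φ t) (xs i))) * ys i) • V i := by
    intro V
    rw [Finset.smul_sum]
    exact Finset.sum_congr rfl fun i _ => smul_comm _ _ _
  rw [hsum, smul_sub lam, smul_smul lam, ← mul_assoc lam, hW]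
  generalize ∑ i, (Real.exp (-(ys i * f (φ t) (xs i))) * ys i) •
    gradient (fun θ => f θ (xs i)) (θinit + Real.exp (-(L * logRadius α lam t)) •
      kernelCoord L θinit α lam φ t) = V
  rw [kernelCoord]
  module

/-- The kernel coordinate follows `targetNorm` times the max-margin direction. -/
theorem sq_norm_kernelCoord_sub_le (hn : 0 < n) {L : ℝ} (hL : 1 ≤ L) {f : Param d → X → ℝ}
    (hf : ∀ x, Differentiable ℝ fun θ => f θ x)
    (hhom : ∀ (x : X) (θ : Param d) (s : ℝ), 0 < s → f (s • θ) x = s ^ L * f θ x)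
    {xs : Fin n → X} {ys : Fin n → ℝ} (hys : ∀ i, ys i = 1 ∨ ys i = -1)
    {θinit : Param d} (hinit : ∀ x, f θinit x = 0)
    (hsep : ∃ h : Param d, ∀ i, 0 < ys i * inner ℝ (ntkFeature f θinit (xs i)) h)
    {C ρ : ℝ} (hC : 0 ≤ C) (hquad : ∀ i, IsQuadApprox (fun θ => f θ (xs i)) θinit C ρ)
    {α lam T κ₀ m : ℝ} (hα : 0 < α) (hlam : 0 < lam)
    {φ : ℝ → Param d} (hφ : IsGradientFlow (regLoss f xs ys lam) (α • θinit) φ)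
    (hT : 0 ≤ T)
    (hκ₀ : κ₀ = targetNorm L (maxMargin (fun i => ntkFeature f θinit (xs i)) ys) α lam 0)
    (hκT : 2 * (L - 1) / maxMargin (fun i => ntkFeature f θinit (xs i)) ys ≤
      L * targetNorm L (maxMargin (fun i => ntkFeature f θinit (xs i)) ys) α lam T)
    (hm : m = Real.exp (L * logRadius α lam T))
    (hdiss : dissipationError n (L * κ₀ / maxMargin (fun i => ntkFeature f θinit (xs i)) ys) + 1 ≤
      3 * L * κ₀ ^ 2)
    (hradius : 3 * κ₀ / m ≤ ρ) (herr : 15 * C * κ₀ ^ 2 / m ≤ 1) :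
    ‖kernelCoord L θinit α lam φ T -
        targetNorm L (maxMargin (fun i => ntkFeature f θinit (xs i)) ys) α lam T •
          maxMarginDir (fun i => ntkFeature f θinit (xs i)) ys‖ ^ 2 ≤
      Real.exp (-(2 * L * lam * T)) * κ₀ ^ 2 +
        (dissipationError n (L * κ₀ / maxMargin (fun i => ntkFeature f θinit (xs i)) ys) + 1) /
          L := by
  set g : Fin n → Param d := fun i => ntkFeature f θinit (xs i) with hg
  set γ := maxMargin g ys with hγ
  set w := maxMarginDir g ys with hw
  set v := kernelCoord L θinit α lam φ with hv
  set κ := targetNorm L γ α lam with hκ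
  set R := dissipationError n (L * κ₀ / γ) + 1 with hR
  have hγ0 : 0 < γ := maxMargin_pos hn hsep
  have hw1 : ‖w‖ = 1 := norm_maxMarginDir hn hsep
  have hL0 : 0 < L := by linarith
  have hm0 : 0 < m := hm ▸ Real.exp_pos _
  have hl_anti : ∀ s t, s ≤ t → logRadius α lam t ≤ logRadius α lam s := by
    intro s t hst
    unfold logRadius
    gcongr
  have hκ_anti : ∀ s t, s ≤ t → κ t ≤ κ s := by
    intro s t hst
    have h := hl_anti s t hst
    have : 0 ≤ 2 * (L - 1) := by linarith
    simp only [hκ, targetNorm]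
    gcongr
  have hκT0 : 0 ≤ κ T := by
    have h : 0 ≤ 2 * (L - 1) / γ := div_nonneg (by linarith) hγ0.le
    exact nonneg_of_mul_nonneg_right (h.trans hκT) hL0
  have hκ_deriv : ∀ t, HasDerivAt κ (-(lam * (2 * (L - 1) / γ))) t := fun t => by
    refine ((((hasDerivAt_logRadius α lam t).const_mul (2 * (L - 1))).sub_const (Real.log lam)).div_const
      γ).congr_deriv ?_
    ring
  have hv_deriv := fun (t : ℝ) (ht : 0 ≤ t) =>
    hasDerivWithinAt_kernelCoord hf hhom hlam hφ ht
  have hz_deriv := fun (t : ℝ) (ht : 0 ≤ t) =>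
    ((hv_deriv t ht).sub ((hκ_deriv t).hasDerivWithinAt.smul_const w)).norm_sq
  have hB_deriv : ∀ t, HasDerivAt (fun t => Real.exp (-(2 * L * lam * t)) * κ₀ ^ 2 + R / L)
      (-(2 * L * lam) * Real.exp (-(2 * L * lam * t)) * κ₀ ^ 2) t := by
    intro t
    refine (((((hasDerivAt_id t).const_mul (2 * L * lam)).fun_neg.exp).mul_const
      (κ₀ ^ 2)).add_const (R / L)).congr_deriv ?_
    simp only [mul_one, id_eq]
    ring
  have hcont : ContinuousOn (fun t => ‖v t - κ t • w‖ ^ 2) (Set.Icc 0 T) := by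
    have hφc : ContinuousOn φ (Set.Icc 0 T) := fun t ht =>
      ((hφ.2 t ht.1).continuousWithinAt).mono Set.Icc_subset_Ici_self
    have hlc : Continuous (logRadius α lam) := by unfold logRadius; fun_prop
    have hκc : Continuous κ := by simp only [hκ]; unfold targetNorm; fun_prop
    simp only [hv, kernelCoord]
    fun_prop
  -- Barrier argument: the strict derivative inequality is needed only at times when the bound is
  -- attained, and equality there gives the a priori control of `v`. The `+ 1` in `R` provides the
  -- strictness.
  refine image_le_of_deriv_right_lt_deriv_boundary (f := fun t => ‖v t - κ t • w‖ ^ 2) hcont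
    (fun t ht => hz_deriv t ht.1) ?_ hB_deriv ?_ (Set.right_mem_Icc.2 hT)
  · have h0 : v 0 = 0 := kernelCoord_zero L θinit hα lam hφ.1
    have hR0 : 0 ≤ R / L := by
      have : 0 ≤ L * κ₀ / γ := by
        rw [hκ₀]
        exact div_nonneg (mul_nonneg hL0.le (hκT0.trans (hκ_anti 0 T hT))) hγ0.le
      rw [hR]; unfold dissipationError
      positivity
    simp only [h0, zero_sub, norm_neg, norm_smul, hw1, mul_one, Real.norm_eq_abs, sq_abs,
      mul_zero, neg_zero, Real.exp_zero, one_mul]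
    rw [hκ₀]
    linarith
  · intro t ht hbd
    have ht0 : 0 ≤ t := ht.1
    have htT : t ≤ T := ht.2.le
    have hκt0 : 0 ≤ κ t := hκT0.trans (hκ_anti t T htT)
    have hκt : κ t ≤ κ₀ := hκ₀ ▸ hκ_anti 0 t ht0
    have hκ₀0 : 0 ≤ κ₀ := hκt0.trans hκt
    have hzsq : ‖v t - κ t • w‖ ^ 2 ≤ (2 * κ₀) ^ 2 := by
      rw [hbd]
      have h1 : Real.exp (-(2 * L * lam * t)) ≤ 1 := Real.exp_le_one_iff.2 (by
        have : 0 ≤ 2 * L * lam * t := by positivity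
        linarith)
      have h2 : R / L ≤ 3 * κ₀ ^ 2 := by
        rw [div_le_iff₀ hL0]; linarith
      nlinarith [mul_le_mul_of_nonneg_right h1 (sq_nonneg κ₀)]
    have hz : ‖v t - κ t • w‖ ≤ 2 * κ₀ := (le_abs_self _).trans (abs_le_of_sq_le_sq hzsq (by positivity))
    have hvn : ‖v t‖ ≤ 3 * κ₀ := by
      have h1 := norm_le_norm_sub_add (v t) (κ t • w)
      rw [norm_smul, hw1, mul_one, Real.norm_of_nonneg hκt0] at h1
      linarith
    set M := Real.exp (L * logRadius α lam t) with hM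
    have hmM : m ≤ M := by
      rw [hm, hM]
      have := hl_anti t T htT
      gcongr
    have hM0 : 0 < M := Real.exp_pos _
    set u := Real.exp (-(L * logRadius α lam t)) • v t with hu
    have hun : ‖u‖ = ‖v t‖ / M := by
      rw [hu, norm_smul, Real.norm_of_nonneg (Real.exp_pos _).le, Real.exp_neg, inv_mul_eq_div]
    have hum : ‖u‖ ≤ 3 * κ₀ / m := by
      rw [hun]
      gcongr
    have hyabs : ∀ i, |ys i| = 1 := fun i => by rcases hys i with h | h <;> simp [h]
    have hval : ∀ i, |ys i * f (φ t) (xs i) - ys i * inner ℝ (g i) (v t)| ≤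
        9 * C * κ₀ ^ 2 / m := by
      intro i
      rw [← mul_sub, abs_mul, hyabs, one_mul]
      calc _ ≤ C * ‖v t‖ ^ 2 / M :=
            abs_sub_inner_kernelCoord_le hhom (hinit _) (hquad i) (hun ▸ hum.trans hradius)
        _ ≤ C * (3 * κ₀) ^ 2 / m := by gcongr
        _ = _ := by ring
    -- With `‖v‖ ≤ 3κ₀` and `‖v - κ w‖ ≤ 2κ₀`, the value error costs `9` and the gradient error `3 ·
    -- 2 = 6`, for a total of `15`.
    have hsmall1 : 9 * C * κ₀ ^ 2 / m ≤ 15 * C * κ₀ ^ 2 / m := by gcongr; norm_num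
    have hkey := inner_dissipation_le hn (g := g)
      (G := fun i => gradient (fun θ => f θ (xs i)) (θinit + u))
      (ys := ys) (q := fun i => ys i * f (φ t) (xs i)) hsep (L := L) (κ := κ t)
      (b := 2 * (L - 1) / γ)
      (W := Real.exp (2 * (L - 1) * logRadius α lam t - Real.log lam)) (v := v t)
      (div_nonneg (by linarith) hγ0.le)
      (hκT.trans (mul_le_mul_of_nonneg_left (hκ_anti t T htT) hL0.le))
      (by
        have : κ t * γ = 2 * (L - 1) * logRadius α lam t - Real.log lam :=
          div_mul_cancel₀ _ hγ0.ne'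
        rw [← hγ, this, ← Real.exp_add, add_neg_cancel, Real.exp_zero])
      (fun i => by
        have := (abs_le.1 (hval i)).2
        linarith)
      (fun i => by
        have h1 := ((hquad i) u (hum.trans hradius)).1
        have h2 : ys i * inner ℝ (gradient (fun θ => f θ (xs i)) (θinit + u) - g i)
            (v t - κ t • w) ≤ 6 * C * κ₀ ^ 2 / m := by
          calc _ ≤ |ys i * inner ℝ (gradient (fun θ => f θ (xs i)) (θinit + u) - g i)
                (v t - κ t • w)| := le_abs_self _
            _ ≤ ‖gradient (fun θ => f θ (xs i)) (θinit + u) - g i‖ * ‖v t - κ t • w‖ := by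
                rw [abs_mul, hyabs, one_mul]; exact abs_real_inner_le_norm _ _
            _ ≤ (C * (3 * κ₀ / m)) * (2 * κ₀) := by
                gcongr
                exact h1.trans (by gcongr)
            _ = _ := by ring
        have h3 : κ t * γ ≤ κ t * (ys i * inner ℝ (g i) w) :=
          mul_le_mul_of_nonneg_left (maxMargin_le g ys i) hκt0
        have h4 := (abs_le.1 (hval i)).1
        rw [inner_sub_left, inner_sub_right (g i), inner_smul_right] at h2
        have h5 : 9 * C * κ₀ ^ 2 / m + 6 * C * κ₀ ^ 2 / m = 15 * C * κ₀ ^ 2 / m := by ring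
        linarith)
    rw [← hγ, ← hw] at hkey
    have hRt : dissipationError n (L * κ t / γ) ≤ dissipationError n (L * κ₀ / γ) :=
      dissipationError_mono (by positivity) (by gcongr)
    have hLR : L * (R / L) = R := mul_div_cancel₀ _ hL0.ne'
    have hrew : ∀ S : Param d, lam • (S - L • v t) - (-(lam * (2 * (L - 1) / γ))) • w =
        lam • (S - L • v t + (2 * (L - 1) / γ) • w) := fun S => by module
    simp only [Pi.sub_apply] at *
    rw [hrew, inner_smul_right]
    rw [hbd] at hkey
    have h6 := mul_le_mul_of_nonneg_left hkey (show 0 ≤ 2 * lam by positivity)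
    have h7 : lam * dissipationError n (L * κ t / γ) < lam * R :=
      mul_lt_mul_of_pos_left (by linarith) hlam
    have h8 : -L * (Real.exp (-(2 * L * lam * t)) * κ₀ ^ 2 + R / L) =
        -L * (Real.exp (-(2 * L * lam * t)) * κ₀ ^ 2) - R := by
      rw [mul_add, neg_mul L (R / L), hLR]; ring
    rw [h8] at h6
    rw [← mul_assoc]
    exact lt_of_le_of_lt h6 (by linarith)

/-! ### Asymptotics -/

theorem tendsto_neg_log_of_isTheta {p : ℝ} (hp : 0 < p) {lam : ℝ → ℝ}
    (hpos : ∀ α, 0 < α → 0 < lam α) (hlam : lam =Θ[atTop] fun α => α ^ (-p)) :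
    Tendsto (fun α => -Real.log (lam α)) atTop atTop := by
  have h0 : Tendsto lam atTop (𝓝[>] 0) := by
    refine tendsto_nhdsWithin_iff.2 ⟨hlam.1.trans_tendsto (tendsto_rpow_neg_atTop hp), ?_⟩
    filter_upwards [eventually_gt_atTop 0] with α hα using hpos α hα
  exact tendsto_neg_atBot_atTop.comp (Real.tendsto_log_nhdsGT_zero.comp h0)

/-- The lower half of the `Θ` bound gives `p log α + log C`; the spare `log α` absorbs the constant.
-/
theorem eventually_neg_log_le_of_isTheta {p : ℝ} {lam : ℝ → ℝ}
    (hpos : ∀ α, 0 < α → 0 < lam α) (hlam : lam =Θ[atTop] fun α => α ^ (-p)) :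
    ∀ᶠ α in atTop, -Real.log (lam α) ≤ (p + 1) * Real.log α := by
  obtain ⟨C, hC, h⟩ := hlam.2.exists_pos
  filter_upwards [h.bound, eventually_gt_atTop 0,
    Real.tendsto_log_atTop.eventually_ge_atTop (Real.log C)] with α h1 hα h2
  rw [Real.norm_of_nonneg (Real.rpow_nonneg hα.le _), Real.norm_of_nonneg (hpos α hα).le] at h1
  have h3 := Real.log_le_log (Real.rpow_pos_of_pos hα _) h1
  rw [Real.log_rpow hα, Real.log_mul hC.ne' (hpos α hα).ne'] at h3
  linarith

/-- The error grows like `k^{3/2}`: the quotient is an explicit combination of `k⁻¹`, `k^{-1/2}` and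
`k⁻²`. -/
theorem tendsto_dissipationError_div_sq (n : ℕ) {A : ℝ} (hA : 0 ≤ A) :
    Tendsto (fun k : ℝ => (dissipationError n (A * k) + 1) / k ^ 2) atTop (𝓝 0) := by
  have h1 : Tendsto (fun k : ℝ => A * k⁻¹ + A * √(2 * n * A) * (√k)⁻¹ + 3 * (k⁻¹) ^ 2) atTop
      (𝓝 (A * 0 + A * √(2 * n * A) * 0 + 3 * 0 ^ 2)) :=
    ((tendsto_inv_atTop_zero.const_mul A).add
      ((tendsto_inv_atTop_zero.comp Real.tendsto_sqrt_atTop).const_mul _)).add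
      ((tendsto_inv_atTop_zero.pow 2).const_mul 3)
  rw [show A * 0 + A * √(2 * n * A) * 0 + 3 * 0 ^ 2 = 0 by ring] at h1
  refine h1.congr' ?_
  filter_upwards [eventually_gt_atTop 0] with k hk
  have hs : 0 < √k := Real.sqrt_pos.2 hk
  have hk2 : k = √k ^ 2 := (Real.sq_sqrt hk.le).symm
  rw [dissipationError, ← mul_assoc (2 * (n : ℝ)), Real.sqrt_mul (x := 2 * n * A) (by positivity)]
  generalize √(2 * n * A) = B
  generalize √k = s at *
  subst hk2
  field_simp
  ring

theorem tendsto_of_sq_norm_sub_le {E : Type*} [NormedAddCommGroup E] {ι : Type*} {l : Filter ι}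
    {u : ι → E} {a : E} {b : ι → ℝ} (h : ∀ᶠ i in l, ‖u i - a‖ ^ 2 ≤ b i)
    (hb : Tendsto b l (𝓝 0)) : Tendsto u l (𝓝 a) := by
  rw [tendsto_iff_norm_sub_tendsto_zero]
  have h1 : Tendsto (fun i => √(b i)) l (𝓝 0) := by
    have h2 := (Real.continuous_sqrt.tendsto 0).comp hb
    rwa [Real.sqrt_zero] at h2
  refine squeeze_zero' (Eventually.of_forall fun i => norm_nonneg _) ?_ h1
  filter_upwards [h] with i hi using Real.le_sqrt_of_sq_le hi

end KernelRegime

end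

theorem mainTheorem1 {d n : ℕ} {X : Type*} (hn : 0 < n) (L : ℝ)
    (f : KernelRegime.Param d → X → ℝ)
    (hsmooth : ∀ x, ContDiff ℝ 2 (fun θ => f θ x))
    (hhom : ∀ (x : X) (θ : KernelRegime.Param d) (s : ℝ), 0 < s → f (s • θ) x = s ^ L * f θ x)
    (xs : Fin n → X) (ys : Fin n → ℝ) (hys : ∀ i, ys i = 1 ∨ ys i = -1)
    (θinit : KernelRegime.Param d) (hinit : ∀ x, f θinit x = 0)
    (hsep : ∃ h : KernelRegime.Param d,
      ∀ i, 0 < ys i * inner ℝ (KernelRegime.ntkFeature f θinit (xs i)) h)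
    (p : ℝ) (hp : 0 < p) (lam : ℝ → ℝ) (hlam_pos : ∀ α, 0 < α → 0 < lam α)
    (hlam : lam =Θ[atTop] fun α => α ^ (-p))
    (θ : ℝ → ℝ → KernelRegime.Param d)
    (hθ : ∀ α, 0 < α →
      KernelRegime.IsGradientFlow (KernelRegime.regLoss f xs ys (lam α)) (α • θinit) (θ α))
    (c : ℝ) (hc0 : 0 < c) (hc1 : c < 1) (x : X) :
    Tendsto
      (fun α : ℝ =>
        f (θ α ((1 - c) / lam α * Real.log α)) x /
          (1 / KernelRegime.maxMargin (fun i => KernelRegime.ntkFeature f θinit (xs i)) ys *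
            Real.log (α ^ (2 * (L - 1) * c) / lam α)))
      atTop
      (𝓝 (inner ℝ (KernelRegime.ntkFeature f θinit x)
        (KernelRegime.maxMarginDir (fun i => KernelRegime.ntkFeature f θinit (xs i)) ys))) := by
  open KernelRegime in
  have hdiff : ∀ x, Differentiable ℝ fun θ => f θ x :=
    fun x => (hsmooth x).differentiable (by norm_num)
  have hL : 1 ≤ L := by
    refine one_le_of_homogeneous (hsmooth (xs ⟨0, hn⟩)) (hhom _) (θ := θinit) fun h0 => ?_
    obtain ⟨h, hh⟩ := hsep
    have := hh ⟨0, hn⟩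
    rw [ntkFeature, h0, inner_zero_left, mul_zero] at this
    exact lt_irrefl _ this
  have hL0 : 0 < L := by linarith
  obtain ⟨C, ρ, hC, hρ, hquad⟩ :=
    exists_forall_isQuadApprox (fun i => hsmooth (xs i)) θinit
  obtain ⟨C', ρ', hρ', hquad'⟩ := exists_isQuadApprox (hsmooth x) θinit
  set γ := maxMargin (fun i => ntkFeature f θinit (xs i)) ys with hγ
  set w := maxMarginDir (fun i => ntkFeature f θinit (xs i)) ys with hw
  have hγ0 : 0 < γ := maxMargin_pos hn hsep
  have hw1 : ‖w‖ = 1 := norm_maxMarginDir hn hsep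
  set T : ℝ → ℝ := fun α => (1 - c) / lam α * Real.log α with hT
  set k : ℝ → ℝ := fun α => targetNorm L γ α (lam α) 0 with hk
  set Z : ℝ → ℝ := fun α => targetNorm L γ α (lam α) (T α) with hZ
  set m : ℝ → ℝ := fun α => Real.exp (L * logRadius α (lam α) (T α)) with hm
  set v : ℝ → Param d := fun α => kernelCoord L θinit α (lam α) (θ α) (T α) with hv
  -- The stopping time is exactly when the decay radius reaches `α^c`.
  have hradT : ∀ α, 0 < α → logRadius α (lam α) (T α) = c * Real.log α := by
    intro α hα
    have := (hlam_pos α hα).ne'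
    simp only [logRadius, hT]
    field_simp
    ring
  have hμ := tendsto_neg_log_of_isTheta hp hlam_pos hlam
  have hμ0 := hμ.eventually_ge_atTop 0
  have hpos := eventually_gt_atTop (0 : ℝ)
  have hlog := Real.tendsto_log_atTop.eventually_ge_atTop 0
  have hZeq : ∀ α, 0 < α → Z α = (2 * (L - 1) * (c * Real.log α) + -Real.log (lam α)) / γ := by
    intro α hα
    simp only [hZ, targetNorm, hradT α hα, sub_eq_add_neg]
  have hkeq : ∀ α, k α = (2 * (L - 1) * Real.log α + -Real.log (lam α)) / γ := by
    intro α
    simp only [hk, targetNorm, logRadius, mul_zero, sub_zero]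
    rw [← sub_eq_add_neg]
  have hZk : ∀ᶠ α in atTop, Z α ≤ k α := by
    filter_upwards [hpos, hlog] with α hα hl
    rw [hZeq α hα, hkeq]
    have : 0 ≤ L - 1 := by linarith
    have : c * Real.log α ≤ Real.log α := mul_le_of_le_one_left hl hc1.le
    gcongr
  -- Initial and final targets are comparable, so errors that are `o(k²)` are also `o(Z²)`.
  have hkZ : ∀ᶠ α in atTop, c * k α ≤ Z α := by
    filter_upwards [hpos, hμ0] with α hα hμα
    rw [hZeq α hα, hkeq, mul_div_assoc']
    have : c * -Real.log (lam α) ≤ -Real.log (lam α) := mul_le_of_le_one_left hμα hc1.le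
    gcongr
    linarith
  have hZtop : Tendsto Z atTop atTop := by
    refine tendsto_atTop_mono' _ ?_ (hμ.atTop_div_const hγ0)
    filter_upwards [hpos, hlog] with α hα hl
    rw [hZeq α hα]
    have : 0 ≤ 2 * (L - 1) * (c * Real.log α) :=
      mul_nonneg (by linarith) (mul_nonneg hc0.le hl)
    gcongr
    linarith
  have hktop : Tendsto k atTop atTop := tendsto_atTop_mono' _ hZk hZtop
  -- Here `k = O(log α)` while `m = α^{Lc}`.
  have hkm2 : Tendsto (fun α => k α ^ 2 / m α) atTop (𝓝 0) := by
    set K := (2 * (L - 1) + (p + 1)) / γ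
    have h1 : Tendsto (fun α => K ^ 2 * (Real.log α ^ 2 / Real.exp (L * c * Real.log α))) atTop
        (𝓝 (K ^ 2 * 0)) :=
      ((isLittleO_pow_exp_pos_mul_atTop (k := 2) (mul_pos hL0 hc0)).tendsto_div_nhds_zero.comp
        Real.tendsto_log_atTop).const_mul (K ^ 2)
    rw [mul_zero] at h1
    refine squeeze_zero' (Eventually.of_forall fun α => by positivity) ?_ h1
    filter_upwards [hpos, eventually_neg_log_le_of_isTheta hlam_pos hlam,
      hktop.eventually_ge_atTop 0] with α hα hle hk0
    have h2 : k α ≤ K * Real.log α := by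
      rw [hkeq, div_mul_eq_mul_div]
      gcongr
      linarith
    simp only [hm, hradT α hα]
    rw [← mul_assoc L, mul_div_assoc', ← mul_pow]
    gcongr
  have hkm1 : Tendsto (fun α => k α / m α) atTop (𝓝 0) := by
    refine squeeze_zero' ?_ ?_ hkm2
    · filter_upwards [hktop.eventually_ge_atTop 0] with α h
      positivity
    · filter_upwards [hktop.eventually_ge_atTop 1] with α h
      gcongr
      nlinarith
  set E : ℝ → ℝ := fun α => dissipationError n (L * k α / γ) + 1 with hE
  have hEk : Tendsto (fun α => E α / k α ^ 2) atTop (𝓝 0) := by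
    refine ((tendsto_dissipationError_div_sq n (div_nonneg hL0.le hγ0.le)).comp hktop).congr ?_
    intro α
    simp only [Function.comp, hE, div_mul_eq_mul_div]
  have hEle : ∀ᶠ α in atTop, E α ≤ 3 * L * k α ^ 2 := by
    filter_upwards [hEk.eventually_le_const (show (0 : ℝ) < 3 * L by linarith),
      hktop.eventually_gt_atTop 0] with α h h0
    rwa [div_le_iff₀ (by positivity)] at h
  have hbound : ∀ᶠ α in atTop, ‖v α - Z α • w‖ ^ 2 ≤
      Real.exp (-(2 * L * (1 - c) * Real.log α)) * k α ^ 2 + E α / L := by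
    filter_upwards [hpos, hlog, hEle, hZtop.eventually_ge_atTop (2 * (L - 1) / γ / L),
      (hkm1.const_mul 3).eventually_le_const (show 3 * 0 < ρ by linarith),
      (hkm2.const_mul (15 * C)).eventually_le_const (show 15 * C * 0 < 1 by linarith)]
      with α hα hl h1 h2 h3 h4
    have hlα := hlam_pos α hα
    have h := sq_norm_kernelCoord_sub_le (T := T α) hn hL hdiff hhom hys hinit hsep hC hquad hα hlα
      (hθ α hα) (mul_nonneg (div_nonneg (by linarith) hlα.le) hl) rfl
      ((div_le_iff₀' hL0).1 h2) rfl h1 (by rwa [mul_div_assoc]) (by rwa [mul_div_assoc])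
    have h5 : 2 * L * lam α * T α = 2 * L * (1 - c) * Real.log α := by
      simp only [hT]
      field_simp
    rw [h5] at h
    exact h
  have hdir : Tendsto (fun α => (Z α)⁻¹ • v α) atTop (𝓝 w) := by
    have hexp : Tendsto (fun α => Real.exp (-(2 * L * (1 - c) * Real.log α))) atTop (𝓝 0) :=
      Real.tendsto_exp_neg_atTop_nhds_zero.comp (Real.tendsto_log_atTop.const_mul_atTop
        (show 0 < 2 * L * (1 - c) from mul_pos (by linarith) (by linarith)))
    have hlim := (hexp.add (hEk.div_const L)).div_const (c ^ 2)
    rw [zero_div, add_zero, zero_div] at hlim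
    refine tendsto_of_sq_norm_sub_le ?_ hlim
    filter_upwards [hbound, hkZ, hktop.eventually_gt_atTop 0] with α h1 h2 h3
    have hZ0 : 0 < Z α := lt_of_lt_of_le (mul_pos hc0 h3) h2
    have h4 : (Z α)⁻¹ • v α - w = (Z α)⁻¹ • (v α - Z α • w) := by
      rw [smul_sub, smul_smul, inv_mul_cancel₀ hZ0.ne', one_smul]
    rw [h4, norm_smul, mul_pow, norm_inv, Real.norm_of_nonneg hZ0.le, inv_pow, inv_mul_eq_div]
    calc ‖v α - Z α • w‖ ^ 2 / Z α ^ 2 ≤ ‖v α - Z α • w‖ ^ 2 / (c * k α) ^ 2 := by gcongr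
      _ ≤ (Real.exp (-(2 * L * (1 - c) * Real.log α)) * k α ^ 2 + E α / L) / (c * k α) ^ 2 := by
        gcongr
      _ = _ := by field_simp
  have hvk : ∀ᶠ α in atTop, ‖v α‖ ≤ 2 * k α := by
    have h1 := hdir.norm
    rw [hw1] at h1
    filter_upwards [h1.eventually_le_const one_lt_two, hZk, hZtop.eventually_gt_atTop 0]
      with α h2 h3 h4
    rw [norm_smul, norm_inv, Real.norm_of_nonneg h4.le, inv_mul_eq_div, div_le_iff₀ h4] at h2
    linarith
  have herr : Tendsto (fun α => f (θ α (T α)) x - inner ℝ (ntkFeature f θinit x) (v α)) atTop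
      (𝓝 0) := by
    have h1 := hkm2.const_mul (4 * |C'|)
    rw [mul_zero] at h1
    refine squeeze_zero_norm' ?_ h1
    filter_upwards [hvk, (hkm1.const_mul 2).eventually_le_const (show 2 * 0 < ρ' by linarith)]
      with α h2 h3
    have hm0 : 0 < m α := Real.exp_pos _
    have h4 : ‖v α‖ / m α ≤ ρ' := by
      refine le_trans ?_ h3
      rw [mul_div_assoc']
      gcongr
    calc _ ≤ C' * ‖v α‖ ^ 2 / m α := abs_sub_inner_kernelCoord_le hhom (hinit x) hquad' h4
      _ ≤ |C'| * (2 * k α) ^ 2 / m α := by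
        gcongr
        exact le_abs_self _
      _ = _ := by ring
  -- Split `f/Z` into its linear part, which converges because `v/Z → w`, and the linearization
  -- error divided by `Z`.
  have hlim : Tendsto (fun α => inner ℝ (ntkFeature f θinit x) ((Z α)⁻¹ • v α) +
      (f (θ α (T α)) x - inner ℝ (ntkFeature f θinit x) (v α)) * (Z α)⁻¹) atTop
      (𝓝 (inner ℝ (ntkFeature f θinit x) w + 0 * 0)) :=
    (tendsto_const_nhds.inner hdir).add (herr.mul hZtop.inv_tendsto_atTop)
  rw [mul_zero, add_zero] at hlim
  refine hlim.congr' ?_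
  filter_upwards [hpos] with α hα
  have hden : 1 / γ * Real.log (α ^ (2 * (L - 1) * c) / lam α) = Z α := by
    rw [hZeq α hα, Real.log_div (Real.rpow_pos_of_pos hα _).ne' (hlam_pos α hα).ne',
      Real.log_rpow hα]
    ring
  rw [hden, inner_smul_right]
  ring
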